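/- Let $K$ be a field and let $A=\bigoplus_{i\ge 0}A_i$ be a commutative graded $K$-algebra with $A_0=K$. Let $P\subset A$ be a finite poset such that $A$ is an algebra with straightening laws (ASL) on $P$ over $K$. This means: the elements of $P$ are homogeneous of positive degree and generate $A$ as a $K$-algebra; the standard monomials $\alpha_1\cdots\alpha_t$ ($t\ge 0$, $\alpha_1\le\dots\le\alpha_t$ in $P$; distinct multichains are counted as distinct monomials) form a $K$-basis of $A$; and for incomparable $\alpha,\beta\in P$, every standard monomial $\gamma_1\cdots\gamma_t$ (with $\gamma_1\le\dots\le\gamma_t$) occurring with nonzero coefficient in the standard representation of $\alpha\beta$ has $t\ge 1$, $\gamma_1<\alpha$ and $\gamma_1<\beta$. Let $M=\bigoplus_{j\in\mathbb Z}M_j$ be a graded $A$-module that is a module with straightening laws (MSL) over $A$ on a finite poset $Q\subset M$ of homogeneous elements. This means that for every $x\in Q$ there is a poset ideal (down-set) $\mathcal I(x)\subset P$ such that the elements $\alpha_1\cdots\alpha_i\,x$ with $x\in Q$, $i\ge 0$, $\alpha_1\le\dots\le\alpha_i$ in $P$ and (if $i\geq 1$) $\alpha_1\notin\mathcal I(x)$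 form a $K$-basis of $M$, and $\alpha x\in\sum_{y\in Q,\;y<x}Ay$ for all $x\in Q$ and $\alpha\in\mathcal I(x)$. Put $d=\max\{\deg p : p\in P\}$ and $m=\max\{\deg q : q\in Q\}$ (with $\max\emptyset=0$), and assume that $m\ge 0$. For $i\ge 0$ let $$t_i(M)=\sup\{\,j\in\mathbb Z : \operatorname{Tor}_i^A(M,K)_j\ne 0\,\}\in[-\infty,\infty],$$ with $\sup\emptyset=-\infty$, where $K=A/\bigoplus_{i>0}A_i$ and $\operatorname{Tor}_i^A(M,K)_j$ is the degree $j$ part of $H_i(F\otimes_A K)$ for any graded free resolution $F$ of $M$ over $A$. Then $$\operatorname{rate}_A(M):=\sup_{i\ge 1}\frac{t_i(M)}{i}\;\le\; d+m .$$ -/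

import Mathlib

/-- The product `α₁ α₂ ⋯ αₜ` in `A` of a list of elements of `P`, where `x : P → A` is the inclusion
of the poset `P` in the algebra `A`. -/
def monomialOf {A P : Type*} [CommRing A] (x : P → A) (l : List P) : A :=
  (l.map x).prod

/-- Multichains `α₁ ≤ α₂ ≤ ⋯ ≤ αₜ` (`t ≥ 0`) of `P`; they index the standard monomials. -/
abbrev Multichain (P : Type*) [PartialOrder P] : Type _ :=
  {l : List P // l.Pairwise (· ≤ ·)}

/-- `A`, graded by `𝒜`, is a (graded) algebra with straightening laws over `K` on the poset `P`,
which is embedded in `A` by `x` (the injectivity of `x` is part of `linearIndependent`). -/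
structure IsASL {K A P : Type*} [Field K] [CommRing A] [Algebra K A] [PartialOrder P]
    (𝒜 : ℤ → Submodule K A) [GradedAlgebra 𝒜] (x : P → A) : Prop where
  /-- `A` lives in nonnegative degrees. -/
  nonneg : ∀ i : ℤ, i < 0 → 𝒜 i = ⊥
  /-- `A₀ = K`. -/
  degree_zero : 𝒜 0 = LinearMap.range (Algebra.linearMap K A)
  /-- The elements of `P` are homogeneous of positive degree. -/
  homogeneous : ∀ p : P, ∃ i : ℤ, 0 < i ∧ x p ∈ 𝒜 i
  /-- `P` generates `A` as a `K`-algebra. -/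
  generates : Algebra.adjoin K (Set.range x) = ⊤
  /-- The standard monomials are linearly independent over `K`. -/
  linearIndependent : LinearIndependent K (fun l : Multichain P => monomialOf x l.1)
  /-- The standard monomials span `A` over `K`. -/
  span_eq_top : Submodule.span K (Set.range fun l : Multichain P => monomialOf x l.1) = ⊤
  /-- Straightening laws: every standard monomial that occurs in the standard representation of a
  product of two incomparable elements `α`, `β` has a first factor below both `α` and `β`. -/
  straightening : ∀ α β : P, ¬ α ≤ β → ¬ β ≤ α → ∀ c : Multichain P →₀ K,
    x α * x β = c.sum (fun l r => r • monomialOf x l.1) →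
      ∀ l ∈ c.support, ∃ γ : P, l.1.head? = some γ ∧ γ < α ∧ γ < β

/-- The index set of the standard elements `α₁ ⋯ αᵢ q`: pairs of `q ∈ Q` and a multichain
`α₁ ≤ ⋯ ≤ αᵢ` (`i ≥ 0`) of `P` such that `α₁ ∉ I q`. -/
abbrev StandardIndex {P Q : Type*} [PartialOrder P] (I : Q → LowerSet P) : Type _ :=
  {s : Q × Multichain P // ∀ α : P, s.2.1.head? = some α → α ∉ I s.1}

/-- The graded `A`-module `M` is a module with straightening laws, over the algebra `A` with
straightening laws on `P`, on the poset `Q`, which is embedded in `M` by `y`. -/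
structure IsMSL {K A M P Q : Type*} [Field K] [CommRing A] [Algebra K A] [AddCommGroup M]
    [Module K M] [Module A M] [PartialOrder P] [PartialOrder Q]
    (x : P → A) (ℳ : ℤ → Submodule K M) (y : Q → M) : Prop where
  /-- The elements of `Q` are homogeneous. -/
  homogeneous : ∀ q : Q, ∃ i : ℤ, y q ∈ ℳ i
  /-- There are poset ideals `I q` of `P` for which the standard elements form a `K`-basis of `M`
  and for which `α q ∈ ∑_{q' < q} A q'` whenever `α ∈ I q`. -/
  exists_ideals : ∃ I : Q → LowerSet P,
    LinearIndependent K (fun s : StandardIndex I => monomialOf x s.1.2.1 • y s.1.1) ∧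
    Submodule.span K
      (Set.range fun s : StandardIndex I => monomialOf x s.1.2.1 • y s.1.1) = ⊤ ∧
    ∀ q : Q, ∀ α ∈ I q, x α • y q ∈ Submodule.span A (y '' Set.Iio q)

/-- The maximum of a finite family of degrees (`0` for the empty family). -/
noncomputable def maxDegree {ι : Type*} [Finite ι] (deg : ι → ℤ) : ℤ := ⨆ i, deg i

/-- The ideal `A₊` generated by the homogeneous elements of positive degree. -/
def positiveIdeal {K A : Type*} [Field K] [CommRing A] [Algebra K A]
    (𝒜 : ℤ → Submodule K A) : Ideal A :=
  Ideal.span {a | ∃ i : ℤ, 0 < i ∧ a ∈ 𝒜 i}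

/-- The homogeneous part of degree `j` of the graded free module `⨁ₖ A(-e k)`, whose `k`-th basis
vector has degree `e k`. -/
noncomputable def freePiece {K A ι : Type*} [Field K] [CommRing A] [Algebra K A]
    (𝒜 : ℤ → Submodule K A) (e : ι → ℤ) (j : ℤ) : Submodule K (ι →₀ A) :=
  ⨅ k, (𝒜 (j - e k)).comap (Finsupp.lapply k)

/-- A graded free resolution `⋯ → F₂ → F₁ → F₀ → M → 0` with `Fₙ = ⨁_{k : ι n} A(-e k)` and
homogeneous maps of degree `0`. -/
structure GradedFreeResolution.{w, uK, uA, uM} {K : Type uK} {A : Type uA} {M : Type uM}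
    [Field K] [CommRing A] [Algebra K A] [AddCommGroup M] [Module K M] [Module A M]
    (𝒜 : ℤ → Submodule K A) (ℳ : ℤ → Submodule K M) where
  /-- The index set of a homogeneous basis of `Fₙ`. -/
  ι : ℕ → Type w
  /-- The degrees of the basis vectors. -/
  e : ∀ n, ι n → ℤ
  /-- The differential. -/
  d : ∀ n, (ι (n + 1) →₀ A) →ₗ[A] (ι n →₀ A)
  /-- The augmentation. -/
  ε : (ι 0 →₀ A) →ₗ[A] M
  d_homogeneous : ∀ n j, ∀ f ∈ freePiece 𝒜 (e (n + 1)) j, d n f ∈ freePiece 𝒜 (e n) j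
  ε_homogeneous : ∀ j, ∀ f ∈ freePiece 𝒜 (e 0) j, ε f ∈ ℳ j
  ε_surjective : Function.Surjective ε
  exact_zero : Function.Exact (d 0) ε
  exact_succ : ∀ n, Function.Exact (d (n + 1)) (d n)

namespace GradedFreeResolution

variable {K A M : Type*} [Field K] [CommRing A] [Algebra K A] [AddCommGroup M] [Module K M]
  [Module A M] {𝒜 : ℤ → Submodule K A} {ℳ : ℤ → Submodule K M} (F : GradedFreeResolution 𝒜 ℳ)

/-- The `n`-th term `Fₙ ⊗_A K = Fₙ ⊗_A A/A₊ = Fₙ / A₊Fₙ` of the complex `F ⊗_A K`. -/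
abbrev Chain (n : ℕ) : Type _ :=
  (F.ι n →₀ A) ⧸ (positiveIdeal 𝒜 • (⊤ : Submodule A (F.ι n →₀ A)))

/-- The differential of `F ⊗_A K`, induced by that of `F`. -/
noncomputable def chainD (n : ℕ) : F.Chain (n + 1) →ₗ[A] F.Chain n :=
  Submodule.mapQ _ _ (F.d n) <| by
    rw [← Submodule.map_le_iff_le_comap, Submodule.map_smul'']
    exact Submodule.smul_mono le_rfl le_top

/-- The homogeneous part of degree `j` of `Fₙ ⊗_A K` (here `K` is concentrated in degree `0`). -/
noncomputable def chainPiece (n : ℕ) (j : ℤ) : Submodule K (F.Chain n) :=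
  (freePiece 𝒜 (F.e n) j).map ((Submodule.mkQ _).restrictScalars K)

/-- The cycles of homological degree `i` and internal degree `j` in `F ⊗_A K`. -/
noncomputable def cycles (i : ℕ) (j : ℤ) : Submodule K (F.Chain i) :=
  match i with
  | 0 => F.chainPiece 0 j
  | i + 1 => F.chainPiece (i + 1) j ⊓ (LinearMap.ker (F.chainD i)).restrictScalars K

/-- The boundaries of homological degree `i` and internal degree `j` in `F ⊗_A K`. -/
noncomputable def boundaries (i : ℕ) (j : ℤ) : Submodule K (F.Chain i) :=
  (F.chainPiece (i + 1) j).map ((F.chainD i).restrictScalars K)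

/-- `Tor_i^A(M, K)_j`, the homology of `F ⊗_A K` in homological degree `i` and internal degree `j`.
-/
abbrev Tor (i : ℕ) (j : ℤ) : Type _ :=
  F.cycles i j ⧸ (F.boundaries i j).comap (F.cycles i j).subtype

/-- `t_i(M) = sup {j | Tor_i^A(M, K)_j ≠ 0}`, which is `-∞` if `Tor_i^A(M, K) = 0`. -/
noncomputable def t (i : ℕ) : EReal :=
  ⨆ (j : ℤ) (_ : Nontrivial (F.Tor i j)), ((j : ℝ) : EReal)

/-- `rate_A(M) = sup_{i ≥ 1} t_i(M) / i`. -/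
noncomputable def rate : EReal :=
  ⨆ (i : ℕ) (_ : 1 ≤ i), F.t i / (i : EReal)

end GradedFreeResolution

/-! ### Standard monomials, ideals generated by poset ideals, and colon ideals -/

section Straightening

open Submodule

/-! Refine `Q` to a linear order and filter `M` by the submodules generated by initial segments.
Standard monomials give normal forms, so the successive quotients are `A` modulo ideals generated by
poset ideals of `P` (`IsMSL.exists_smul_mem_span_iff`).

This property, `HasPosetQuotients`, passes to first syzygies (`HasPosetQuotients.exists_ker`). The
relations among the generators `y k` are generated by one syzygy for each pair `(k, p)` with `p ∈ I
k`, with leading coefficient `x p`. For the lexicographic order their colon ideals have the form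
`(S) : x p`, where `S` is a poset ideal that contains everything below `p` but not `p`. By
straightening, such a colon ideal is generated by the poset ideal `{q | ¬ p ≤ q}`
(`IsASL.mul_mem_span_iff`). Each passage raises the bound on generator degrees by `d`, so an `i`-th
syzygy module is generated in degrees at most `m + i * d`, which is at most `i * (d + m)` for `i ≥
1`.

The given resolution `F` need not be the one built this way. In the spirit of Schanuel's lemma, its
syzygy modules are retracts of the constructed ones up to maps that factor through a free module
(`exists_comparison`), and this is enough to bound Tor (`subsingleton_tor`). -/

/-- The multichains whose first element lies in `I`. -/
def headIn {P : Type*} [PartialOrder P] (I : Set P) : Set (Multichain P) :=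
  {l | ∃ γ ∈ I, l.1.head? = some γ}

theorem Multichain.pairwise_cons {P : Type*} [PartialOrder P] {p : P} (l : Multichain P)
    (h : ∀ γ, l.1.head? = some γ → p ≤ γ) : (p :: l.1).Pairwise (· ≤ ·) := by
  obtain ⟨l, hl⟩ := l
  refine List.pairwise_cons.2 ⟨?_, hl⟩
  cases l with
  | nil => simp
  | cons a l =>
    have h1 : p ≤ a := h a rfl
    intro b hb
    rcases List.mem_cons.1 hb with rfl | hb
    · exact h1
    · exact h1.trans ((List.pairwise_cons.1 hl).1 b hb)

/-- If `T` sends a family `v` injectively to members of a linearly independent family `w` outside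
`S`, then no nonzero element of the span of `v` is mapped into the span of `S`. -/
theorem eq_zero_of_map_mem_span_image {K V W ι κ : Type*} [Field K] [AddCommGroup V] [Module K V]
    [AddCommGroup W] [Module K W] {w : κ → W} (hw : LinearIndependent K w) {v : ι → V}
    {f : ι → κ} (hf : Function.Injective f) (T : V →ₗ[K] W) (hT : ∀ i, T (v i) = w (f i))
    {S : Set κ} (hS : ∀ i, f i ∉ S) {a : V} (ha : a ∈ span K (Set.range v))
    (h : T a ∈ span K (w '' S)) : a = 0 := by
  obtain ⟨c, rfl⟩ := (Finsupp.mem_span_range_iff_exists_finsupp).1 ha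
  have hTc : T (c.sum fun i r => r • v i) = Finsupp.linearCombination K (w ∘ f) c := by
    simp [Finsupp.linearCombination_apply, Finsupp.sum, map_sum, hT]
  have hdis : Disjoint (Set.range f) S := by
    rw [Set.disjoint_left]
    rintro _ ⟨i, rfl⟩
    exact hS i
  have h2 : T (c.sum fun i r => r • v i) ∈ span K (w '' Set.range f) := by
    rw [hTc, ← Set.range_comp]
    exact (Finsupp.mem_span_range_iff_exists_finsupp).2 ⟨c, rfl⟩
  have h0 := Submodule.disjoint_def.1 (hw.disjoint_span_image hdis) _ h2 h
  rw [hTc] at h0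
  have hc := (linearIndependent_iff.1 (hw.comp f hf)) c h0
  simp [hc]

variable {K A P : Type*} [Field K] [CommRing A] [Algebra K A] [PartialOrder P]

theorem monomialOf_cons {A P : Type*} [CommRing A] (x : P → A) (p : P) (l : List P) :
    monomialOf x (p :: l) = x p * monomialOf x l := by
  simp [monomialOf]

/-- The `K`-span of the standard monomials whose first element lies in `I`. -/
def headSpan (K : Type*) [Field K] [Algebra K A] (x : P → A) (I : Set P) : Submodule K A :=
  span K ((fun l : Multichain P => monomialOf x l.1) '' headIn I)

theorem headSpan_le_span (x : P → A) (I : Set P) {a : A} (ha : a ∈ headSpan K x I) :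
    a ∈ Ideal.span (x '' I) := by
  have : headSpan K x I ≤ (Ideal.span (x '' I)).restrictScalars K := by
    refine span_le.2 ?_
    rintro _ ⟨⟨l, hl⟩, ⟨γ, hγ, h⟩, rfl⟩
    cases l with
    | nil => simp at h
    | cons b l =>
      obtain rfl : b = γ := by simpa using h
      simp only [monomialOf_cons]
      exact Ideal.mul_mem_right _ _ (Ideal.subset_span ⟨b, hγ, rfl⟩)
  exact this ha

namespace IsASL

variable {𝒜 : ℤ → Submodule K A} [GradedAlgebra 𝒜] {x : P → A}

theorem mul_mem_span_Iio (hA : IsASL 𝒜 x) {α β : P} (h1 : ¬ α ≤ β) (h2 : ¬ β ≤ α) :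
    x α * x β ∈ headSpan K x (Set.Iio α ∩ Set.Iio β) := by
  have hmem : x α * x β ∈ span K (Set.range fun l : Multichain P => monomialOf x l.1) := by
    rw [hA.span_eq_top]; trivial
  obtain ⟨c, hc⟩ := (Finsupp.mem_span_range_iff_exists_finsupp).1 hmem
  have := hA.straightening α β h1 h2 c hc.symm
  rw [← hc]
  refine sum_mem fun l hl => smul_mem _ _ (subset_span ⟨l, ?_, rfl⟩)
  obtain ⟨γ, h, h3, h4⟩ := this l hl
  exact ⟨γ, ⟨h3, h4⟩, h⟩

/-- Induction on `α`. Multiply a standard monomial with head `β` by `x α`. If `α ≤ β`, the product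
is standard with head `α`. If `β < α`, or if the two are incomparable (by straightening), the
product lies in the ideal generated by the elements below `α`, where the induction hypothesis
applies. -/
theorem mul_mem_headSpan [Finite P] (hA : IsASL 𝒜 x) {I : Set P} (hI : IsLowerSet I) (α : P) :
    α ∈ I → ∀ a : A, x α * a ∈ headSpan K x I := by
  have : WellFoundedLT P := Finite.to_wellFoundedLT
  induction α using WellFoundedLT.induction with
  | ind α ih =>
  intro hα a
  have ih' : ∀ v ∈ Ideal.span (x '' Set.Iio α), v ∈ headSpan K x I := by
    intro v hv
    have : ∀ a : A, a * v ∈ headSpan K x I := by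
      induction hv using Submodule.span_induction with
      | mem v hv =>
        obtain ⟨γ, hγ, rfl⟩ := hv
        intro a
        rw [mul_comm]
        exact ih γ hγ (hI hγ.le hα) a
      | zero => simp
      | add v w _ _ hv hw => intro a; rw [mul_add]; exact add_mem (hv a) (hw a)
      | smul b v _ hv => intro a; rw [smul_eq_mul, ← mul_assoc]; exact hv _
    simpa using this 1
  have ha : a ∈ span K (Set.range fun l : Multichain P => monomialOf x l.1) := by
    rw [hA.span_eq_top]; trivial
  induction ha using Submodule.span_induction with
  | zero => simp
  | add v w _ _ hv hw => rw [mul_add]; exact add_mem hv hw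
  | smul b v _ hv => rw [mul_smul_comm]; exact smul_mem _ _ hv
  | mem v hv =>
    obtain ⟨⟨l, hl⟩, rfl⟩ := hv
    by_cases hle : ∀ γ, l.head? = some γ → α ≤ γ
    · exact subset_span ⟨⟨α :: l, Multichain.pairwise_cons ⟨l, hl⟩ hle⟩, ⟨α, hα, rfl⟩,
        monomialOf_cons x α l⟩
    · push Not at hle
      obtain ⟨β, hβ, hle⟩ := hle
      apply ih'
      cases l with
      | nil => simp at hβ
      | cons b l =>
        obtain rfl : b = β := by simpa using hβ
        simp only [monomialOf_cons]
        by_cases hba : b ≤ α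
        · rw [mul_left_comm]
          exact Ideal.mul_mem_right _ _
            (Ideal.subset_span ⟨b, lt_of_le_not_ge hba hle, rfl⟩)
        · rw [← mul_assoc]
          refine Ideal.mul_mem_right _ _ ?_
          exact Ideal.span_mono (Set.image_mono Set.inter_subset_left)
            (headSpan_le_span x _ (hA.mul_mem_span_Iio hle hba))

theorem mem_span_iff [Finite P] (hA : IsASL 𝒜 x) {I : Set P} (hI : IsLowerSet I) (a : A) :
    a ∈ Ideal.span (x '' I) ↔ a ∈ headSpan K x I := by
  refine ⟨fun hv => ?_, headSpan_le_span x I⟩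
  have : ∀ b : A, b * a ∈ headSpan K x I := by
    induction hv using Submodule.span_induction with
    | mem v hv =>
      obtain ⟨γ, hγ, rfl⟩ := hv
      intro a
      rw [mul_comm]
      exact hA.mul_mem_headSpan hI γ hγ a
    | zero => simp
    | add v w _ _ hv hw => intro a; rw [mul_add]; exact add_mem (hv a) (hw a)
    | smul b v _ hv => intro a; rw [smul_eq_mul, ← mul_assoc]; exact hv _
  simpa using this 1

/-- Normal form modulo the ideal of `I`: for a lower set `I`, the summand `b` lies in the ideal and
`c` is the remainder. -/
theorem exists_add (hA : IsASL 𝒜 x) (I : Set P) (a : A) :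
    ∃ b ∈ headSpan K x I, ∃ c ∈ span K (Set.range fun l : ↥(headIn I)ᶜ => monomialOf x l.1.1),
      b + c = a := by
  have ha : a ∈ span K (Set.range fun l : Multichain P => monomialOf x l.1) := by
    rw [hA.span_eq_top]; trivial
  rw [← Set.image_univ, ← Set.union_compl_self (headIn I), Set.image_union, span_union] at ha
  obtain ⟨b, hb, c, hc, h⟩ := mem_sup.1 ha
  refine ⟨b, hb, c, ?_, h⟩
  rwa [Set.image_eq_range] at hc

/-- The colon ideals of the ideals generated by poset ideals. -/
theorem mul_mem_span_iff [Finite P] (hA : IsASL 𝒜 x) {I : Set P} (hI : IsLowerSet I) {p : P}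
    (hp : p ∉ I) (hlt : Set.Iio p ⊆ I) (a : A) :
    a * x p ∈ Ideal.span (x '' I) ↔ a ∈ Ideal.span (x '' {q | ¬ p ≤ q}) := by
  have key : ∀ a ∈ Ideal.span (x '' {q | ¬ p ≤ q}), a * x p ∈ Ideal.span (x '' I) := by
    intro a ha
    induction ha using Submodule.span_induction with
    | zero => simp
    | add v w _ _ hv hw => rw [add_mul]; exact add_mem hv hw
    | smul b v _ hv => rw [smul_eq_mul, mul_assoc]; exact Ideal.mul_mem_left _ _ hv
    | mem v hv =>
      obtain ⟨q, hq, rfl⟩ := hv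
      by_cases hqp : q ≤ p
      · exact Ideal.mul_mem_right _ _
          (Ideal.subset_span ⟨q, hlt (lt_of_le_not_ge hqp hq), rfl⟩)
      · exact Ideal.span_mono (Set.image_mono (Set.inter_subset_right.trans hlt))
            (headSpan_le_span x _ (hA.mul_mem_span_Iio hqp hq))
  refine ⟨fun h => ?_, key a⟩
  obtain ⟨b, hb, c, hc, rfl⟩ := hA.exists_add {q | ¬ p ≤ q} a
  have hb' := headSpan_le_span x _ hb
  have hcp : c * x p ∈ Ideal.span (x '' I) := by
    have := sub_mem h (key b hb')
    rwa [add_mul, add_sub_cancel_left] at this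
  rw [hA.mem_span_iff hI] at hcp
  have hhead : ∀ l : ↥(headIn {q | ¬ p ≤ q})ᶜ, ∀ γ, l.1.1.head? = some γ → p ≤ γ := by
    intro l γ h
    by_contra hγ
    exact l.2 ⟨γ, hγ, h⟩
  -- Multiplication by `x p` prepends `p` to every monomial of the remainder `c`. The results are
  -- distinct standard monomials with head `p ∉ I`, yet `c * x p` is spanned by those with head in
  -- `I`.
  have : c = 0 := by
    refine eq_zero_of_map_mem_span_image hA.linearIndependent
      (f := fun l : ↥(headIn {q | ¬ p ≤ q})ᶜ =>
        (⟨p :: l.1.1, Multichain.pairwise_cons l.1 (hhead l)⟩ : Multichain P))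
      ?_ (LinearMap.mulRight K (x p)) ?_ ?_ hc hcp
    · intro l l' h
      simpa [Subtype.ext_iff] using h
    · intro l
      simp [monomialOf_cons, mul_comm]
    · rintro l ⟨γ, hγ, h⟩
      obtain rfl : p = γ := by simpa using h
      exact hp hγ
  rw [this, add_zero]
  exact hb'

end IsASL

/-- The colon modules in a module with straightening laws, for a linear extension of `Q`. -/
theorem IsMSL.exists_smul_mem_span_iff {M Q : Type*} [AddCommGroup M] [Module K M] [Module A M]
    [IsScalarTower K A M] [PartialOrder Q] [Finite Q] {𝒜 : ℤ → Submodule K A} [GradedAlgebra 𝒜]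
    [Finite P] {ℳ : ℤ → Submodule K M} {x : P → A} {y : Q → M} (hA : IsASL 𝒜 x)
    (hM : IsMSL x ℳ y) :
    ∃ I : LinearExtension Q → LowerSet P,
      span A (Set.range y) = ⊤ ∧ ∀ (q : LinearExtension Q) (a : A),
        a • y q ∈ span A ((fun q : LinearExtension Q => y q) '' Set.Iio q) ↔
          a ∈ Ideal.span (x '' I q) := by
  obtain ⟨I, hli, htop, hI⟩ := hM.exists_ideals
  let y' : LinearExtension Q → M := fun q => y q
  have hI' : ∀ q : LinearExtension Q, ∀ a ∈ Ideal.span (x '' I q),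
      a • y q ∈ span A (y' '' Set.Iio q) := by
    intro q a ha
    induction ha using Submodule.span_induction with
    | zero => simp
    | add v w _ _ hv hw => rw [add_smul]; exact add_mem hv hw
    | smul b v _ hv => rw [smul_assoc]; exact smul_mem _ _ hv
    | mem v hv =>
      obtain ⟨α, hα, rfl⟩ := hv
      refine span_mono ?_ (hI q α hα)
      rintro _ ⟨q', hq', rfl⟩
      refine ⟨q', ?_, rfl⟩
      exact lt_of_le_of_ne (toLinearExtension.monotone (le_of_lt hq')) (ne_of_lt hq' :)
  -- `W S` is the `K`-span of the standard elements over `S`. Repeated reduction modulo `I q` puts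
  -- `a • y q` in `W (Set.Iic q)`.
  let W : Set (LinearExtension Q) → Submodule K M := fun S =>
    span K ((fun s : StandardIndex I => monomialOf x s.1.2.1 • y s.1.1) ''
      {s | (s.1.1 : LinearExtension Q) ∈ S})
  have hnot : ∀ (q : Q) (l : ↥(headIn (I q : Set P))ᶜ), ∀ α : P, l.1.1.head? = some α → α ∉ I q :=
    fun q l α h hα => l.2 ⟨α, hα, h⟩
  have hW : ∀ (q q₀ : LinearExtension Q), q ≤ q₀ → ∀ a : A, a • y q ∈ W (Set.Iic q₀) := by
    have : Finite (LinearExtension Q) := inferInstanceAs (Finite Q)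
    have : WellFoundedLT (LinearExtension Q) := Finite.to_wellFoundedLT
    intro q
    induction q using WellFoundedLT.induction with
    | ind q ih =>
    intro q₀ hq a
    obtain ⟨b, hb, c, hc, rfl⟩ := hA.exists_add (I q) a
    rw [add_smul]
    refine add_mem ?_ ?_
    · have h1 := hI' q b (headSpan_le_span x _ hb)
      have : ∀ v ∈ span A (y' '' Set.Iio q), ∀ a : A, a • v ∈ W (Set.Iic q₀) := by
        intro v hv
        induction hv using Submodule.span_induction with
        | zero => simp
        | add v w _ _ hv hw => intro a; rw [smul_add]; exact add_mem (hv a) (hw a)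
        | smul b v _ hv => intro a; rw [smul_smul]; exact hv _
        | mem v hv =>
          obtain ⟨q', hq', rfl⟩ := hv
          exact ih q' hq' q₀ (hq'.le.trans hq)
      simpa using this _ h1 1
    · induction hc using Submodule.span_induction with
      | zero => simp
      | add v w _ _ hv hw => rw [add_smul]; exact add_mem hv hw
      | smul b v _ hv => rw [smul_assoc]; exact smul_mem _ _ hv
      | mem v hv =>
        obtain ⟨l, rfl⟩ := hv
        let s : StandardIndex I := ⟨(q, l.1), hnot q l⟩
        have hs : s ∈ {s : StandardIndex I | (s.1.1 : LinearExtension Q) ∈ Set.Iic q₀} := hq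
        exact subset_span (Set.mem_image_of_mem _ hs)
  refine ⟨I, ?_, fun q a => ⟨fun h => ?_, hI' q a⟩⟩
  · rw [eq_top_iff]
    intro v _
    have hv : v ∈ span K (Set.range fun s : StandardIndex I => monomialOf x s.1.2.1 • y s.1.1) := by
      rw [htop]; trivial
    have : span K (Set.range fun s : StandardIndex I => monomialOf x s.1.2.1 • y s.1.1) ≤
        (span A (Set.range y)).restrictScalars K := by
      refine span_le.2 ?_
      rintro _ ⟨s, rfl⟩
      exact smul_mem _ _ (subset_span (Set.mem_range_self (f := y) s.1.1))
    exact this hv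
  · obtain ⟨b, hb, c, hc, rfl⟩ := hA.exists_add (I q) a
    have hb' := headSpan_le_span x _ hb
    have hcq : c • y q ∈ span A (y' '' Set.Iio q) := by
      have := sub_mem h (hI' q b hb')
      rwa [add_smul, add_sub_cancel_left] at this
    have hle : ∀ v ∈ span A (y' '' Set.Iio q), ∀ a : A, a • v ∈ W (Set.Iio q) := by
      intro v hv
      induction hv using Submodule.span_induction with
      | zero => simp
      | add v w _ _ hv hw => intro a; rw [smul_add]; exact add_mem (hv a) (hw a)
      | smul b v _ hv => intro a; rw [smul_smul]; exact hv _
      | mem v hv =>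
        obtain ⟨q', hq', rfl⟩ := hv
        intro a
        refine span_mono (Set.image_mono ?_) (hW q' q' le_rfl a)
        intro s hs
        exact lt_of_le_of_lt (Set.mem_Iic.1 hs) (Set.mem_Iio.1 hq')
    have hcW : c • y q ∈ W (Set.Iio q) := by simpa using hle _ hcq 1
    -- The remainder satisfies two incompatible conditions: `c • y q` is a combination of standard
    -- elements over `q` itself and also of those strictly below `q`.
    have : c = 0 := by
      refine eq_zero_of_map_mem_span_image hli
        (f := fun l : ↥(headIn (I q : Set P))ᶜ => (⟨(q, l.1), hnot q l⟩ : StandardIndex I))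
        ?_ ((LinearMap.toSpanSingleton A M (y q)).restrictScalars K) ?_ ?_ hc hcW
      · intro l l' h
        have := congrArg (fun s : StandardIndex I => s.1.2) h
        exact Subtype.ext this
      · intro l
        simp
      · intro l hl
        exact lt_irrefl q (Set.mem_Iio.1 hl)
    rw [this, add_zero]
    exact hb'

end Straightening
-- Graded projections and graded free modules
section Graded

open Submodule

variable {K A P : Type*} [Field K] [CommRing A] [Algebra K A] [PartialOrder P]

/-- The maps `π j : N → N` behave like the projections to the homogeneous parts of a graded
`A`-module `N`. -/
def IsGradedProj (𝒜 : ℤ → Submodule K A) {N : Type*} [AddCommGroup N] [Module A N]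
    (π : ℤ → N →+ N) : Prop :=
  ∀ i j, ∀ a ∈ 𝒜 i, ∀ n, π (i + j) (a • n) = a • π j n

/-- With respect to the projections `π j`, the element `n` is homogeneous of degree `e`. -/
def IsPure {N : Type*} [AddCommGroup N] (π : ℤ → N →+ N) (e : ℤ) (n : N) : Prop :=
  ∀ j, π j n = if j = e then n else 0

theorem IsPure.proj_self {N : Type*} [AddCommGroup N] {π : ℤ → N →+ N} {e : ℤ} {n : N}
    (h : IsPure π e n) : π e n = n := by
  simpa using h e

variable {𝒜 : ℤ → Submodule K A} [GradedAlgebra 𝒜]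

theorem IsGradedProj.apply_smul {N : Type*} [AddCommGroup N] [Module A N] {π : ℤ → N →+ N}
    (h : IsGradedProj 𝒜 π) {e : ℤ} {n : N} (hn : IsPure π e n) (j : ℤ) (a : A) :
    π j (a • n) = (DirectSum.decompose 𝒜 a (j - e) : A) • n := by
  induction a using DirectSum.Decomposition.inductionOn 𝒜 with
  | zero => simp
  | add a b ha hb => simp [add_smul, ha, hb]
  | @homogeneous i m =>
    have := h i (j - i) m m.2 n
    rw [add_sub_cancel] at this
    rw [this, hn, DirectSum.decompose_coe, DirectSum.coe_of_apply]
    by_cases hij : i = j - e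
    · rw [if_pos (by omega), if_pos hij]
    · rw [if_neg (by omega), if_neg hij]; simp

/-- The projection of a graded free module to its part of degree `j`. -/
noncomputable def freeProj {ι : Type*} (𝒜 : ℤ → Submodule K A) [GradedAlgebra 𝒜] (e : ι → ℤ)
    (j : ℤ) : (ι →₀ A) →+ (ι →₀ A) :=
  Finsupp.liftAddHom fun k => (Finsupp.singleAddHom k).comp (GradedRing.proj 𝒜 (j - e k))

section Free

variable {ι : Type*} (e : ι → ℤ)

theorem freeProj_single (j : ℤ) (k : ι) (a : A) :
    freeProj 𝒜 e j (Finsupp.single k a) =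
      Finsupp.single k (DirectSum.decompose 𝒜 a (j - e k) : A) := by
  simp [freeProj, GradedRing.proj_apply]

theorem freeProj_apply (j : ℤ) (f : ι →₀ A) (k : ι) :
    freeProj 𝒜 e j f k = (DirectSum.decompose 𝒜 (f k) (j - e k) : A) := by
  classical
  induction f using Finsupp.induction_linear with
  | zero => simp
  | add f g hf hg => simp [hf, hg]
  | single l a =>
    rw [freeProj_single]
    by_cases h : l = k
    · subst h; simp
    · simp [h]

theorem isGradedProj_freeProj : IsGradedProj 𝒜 (freeProj 𝒜 e) := by
  intro i j a ha f
  ext k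
  rw [freeProj_apply, Finsupp.smul_apply, Finsupp.smul_apply, freeProj_apply, smul_eq_mul,
    smul_eq_mul, add_sub_assoc, DirectSum.coe_decompose_mul_add_of_left_mem 𝒜 ha]

omit [GradedAlgebra 𝒜] in
theorem mem_freePiece_iff {j : ℤ} {f : ι →₀ A} :
    f ∈ freePiece 𝒜 e j ↔ ∀ k, f k ∈ 𝒜 (j - e k) := by
  simp [freePiece]

theorem freeProj_mem (j : ℤ) (f : ι →₀ A) : freeProj 𝒜 e j f ∈ freePiece 𝒜 e j := by
  rw [mem_freePiece_iff]
  intro k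
  rw [freeProj_apply]
  exact SetLike.coe_mem _

variable {e} in
theorem isPure_freeProj {j : ℤ} {f : ι →₀ A} (hf : f ∈ freePiece 𝒜 e j) :
    IsPure (freeProj 𝒜 e) j f := by
  intro i
  rw [mem_freePiece_iff] at hf
  ext k
  rw [freeProj_apply]
  split_ifs with h
  · subst h; exact DirectSum.decompose_of_mem_same 𝒜 (hf k)
  · rw [DirectSum.decompose_of_mem_ne 𝒜 (hf k) (by omega)]; rfl

theorem single_mem_freePiece (k : ι) : Finsupp.single k (1 : A) ∈ freePiece 𝒜 e (e k) := by
  classical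
  rw [mem_freePiece_iff]
  intro l
  by_cases h : k = l
  · subst h; simpa using SetLike.GradedOne.one_mem
  · simp [h]

theorem map_freeProj {N : Type*} [AddCommGroup N] [Module A N] {π : ℤ → N →+ N}
    (h : IsGradedProj 𝒜 π) (T : (ι →₀ A) →ₗ[A] N)
    (hT : ∀ k, IsPure π (e k) (T (Finsupp.single k 1))) (j : ℤ) (f : ι →₀ A) :
    T (freeProj 𝒜 e j f) = π j (T f) := by
  induction f using Finsupp.induction_linear with
  | zero => simp
  | add f g hf hg => simp [hf, hg]
  | single k a =>
    have hs : ∀ b : A, T (Finsupp.single k b) = b • T (Finsupp.single k 1) := by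
      intro b; rw [← map_smul, Finsupp.smul_single, smul_eq_mul, mul_one]
    rw [freeProj_single, hs, hs a, h.apply_smul (hT k)]

end Free

/-! ### Modules with poset quotients and their first syzygies -/

/-- The graded module `N` is generated by homogeneous elements `y k` of degree at most `c` such that
the colon ideals of the chain of submodules generated by initial segments of `y` are generated by
poset ideals of `P`. -/
structure HasPosetQuotients (𝒜 : ℤ → Submodule K A) (x : P → A) (c : ℤ) {N ι : Type*}
    [AddCommGroup N] [Module A N] [LinearOrder ι] (π : ℤ → N →+ N) (y : ι → N) (e : ι → ℤ)
    (I : ι → LowerSet P) : Prop where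
  isGradedProj : IsGradedProj 𝒜 π
  isPure : ∀ k, IsPure π (e k) (y k)
  degree_le : ∀ k, e k ≤ c
  span_eq_top : span A (Set.range y) = ⊤
  smul_mem_iff : ∀ k a, a • y k ∈ span A (y '' Set.Iio k) ↔ a ∈ Ideal.span (x '' I k)

namespace HasPosetQuotients

variable {x : P → A} {c : ℤ} {N ι : Type*} [AddCommGroup N] [Module A N] [LinearOrder ι]
  {π : ℤ → N →+ N} {y : ι → N} {e : ι → ℤ} {I : ι → LowerSet P}

theorem map_freeProj (h : HasPosetQuotients 𝒜 x c π y e I) (j : ℤ) (f : ι →₀ A) :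
    Finsupp.linearCombination A y (freeProj 𝒜 e j f) = π j (Finsupp.linearCombination A y f) :=
  _root_.map_freeProj e h.isGradedProj _ (by simpa using h.isPure) j f

omit [GradedAlgebra 𝒜] in
theorem surjective (h : HasPosetQuotients 𝒜 x c π y e I) :
    Function.Surjective (Finsupp.linearCombination A y) := by
  rw [← LinearMap.range_eq_top, Finsupp.range_linearCombination, h.span_eq_top]

theorem exists_mem_freePiece (h : HasPosetQuotients 𝒜 x c π y e I) {j : ℤ} {n : N}
    (hn : π j n = n) : ∃ f ∈ freePiece 𝒜 e j, Finsupp.linearCombination A y f = n := by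
  obtain ⟨f, rfl⟩ := h.surjective n
  exact ⟨freeProj 𝒜 e j f, freeProj_mem e j f, by rw [h.map_freeProj, hn]⟩

/-- A homogeneous expression of `n` in the generators has coefficients of degree `j - e k`, which is
positive. -/
theorem mem_positiveIdeal_smul_top (h : HasPosetQuotients 𝒜 x c π y e I) {j : ℤ} {n : N}
    (hn : π j n = n) (hj : c < j) : n ∈ positiveIdeal 𝒜 • (⊤ : Submodule A N) := by
  obtain ⟨f, hf, rfl⟩ := h.exists_mem_freePiece hn
  rw [Finsupp.linearCombination_apply]
  refine sum_mem fun k _ => smul_mem_smul (Ideal.subset_span ⟨j - e k, ?_, ?_⟩) trivial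
  · have := h.degree_le k; omega
  · exact (mem_freePiece_iff e).1 hf k

/-- The index set of generators of the first syzygy module. -/
abbrev KerIndex (I : ι → LowerSet P) : Type _ :=
  {s : ι ×ₗ LinearExtension P // ((ofLex s).2 : P) ∈ I (ofLex s).1}

instance [Finite P] [Finite ι] : Finite (KerIndex I) :=
  have : Finite (ι ×ₗ LinearExtension P) := inferInstanceAs (Finite (ι × P))
  Subtype.finite

omit [GradedAlgebra 𝒜] in
theorem comp_orderIso {ι' : Type*} [LinearOrder ι'] (h : HasPosetQuotients 𝒜 x c π y e I)
    (f : ι' ≃o ι) : HasPosetQuotients 𝒜 x c π (y ∘ f) (e ∘ f) (I ∘ f) where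
  isGradedProj := h.isGradedProj
  isPure k := h.isPure (f k)
  degree_le k := h.degree_le (f k)
  span_eq_top := by rw [f.surjective.range_comp, h.span_eq_top]
  smul_mem_iff k a := by
    rw [Set.image_comp, f.image_Iio]
    exact h.smul_mem_iff (f k) a

/-- Rewriting `x p • y k` through earlier generators gives a syzygy with leading coefficient `x p`.
Its component of degree `e k + degP p` is still a syzygy with the same leading coefficient. -/
theorem exists_syzygy (h : HasPosetQuotients 𝒜 x c π y e I) {degP : P → ℤ}
    (hdegP : ∀ p, x p ∈ 𝒜 (degP p)) (k : ι) (p : P) (hp : p ∈ I k) :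
    ∃ z ∈ LinearMap.ker (Finsupp.linearCombination A y), z ∈ freePiece 𝒜 e (e k + degP p) ∧
      z k = x p ∧ ∀ l, k < l → z l = 0 := by
  have h1 := (h.smul_mem_iff k (x p)).2 (Ideal.subset_span ⟨p, hp, rfl⟩)
  obtain ⟨w, hw, hwy⟩ := (Finsupp.mem_span_image_iff_linearCombination A).1 h1
  have hw0 : ∀ l, k ≤ l → w l = 0 := by
    intro l hl
    by_contra h0
    exact not_lt.2 hl (hw (Finsupp.mem_support_iff.2 h0))
  refine ⟨freeProj 𝒜 e (e k + degP p) (Finsupp.single k (x p) - w), ?_, freeProj_mem e _ _, ?_, ?_⟩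
  · rw [LinearMap.mem_ker, h.map_freeProj, map_sub, hwy]
    simp
  · rw [freeProj_apply, Finsupp.sub_apply, hw0 k le_rfl, Finsupp.single_eq_same, sub_zero,
      add_sub_cancel_left, DirectSum.decompose_of_mem_same 𝒜 (hdegP p)]
  · intro l hl
    rw [freeProj_apply, Finsupp.sub_apply, hw0 l hl.le, Finsupp.single_eq_of_ne hl.ne']
    simp

/-- The first syzygy module of a module whose quotients are defined by poset ideals is a module of
the same kind. -/
theorem exists_ker [Finite P] [Finite ι] (hA : IsASL 𝒜 x) (h : HasPosetQuotients 𝒜 x c π y e I)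
    {degP : P → ℤ} (hdegP : ∀ p, x p ∈ 𝒜 (degP p)) {d : ℤ} (hd : ∀ p, degP p ≤ d) :
    ∃ (π' : ℤ → LinearMap.ker (Finsupp.linearCombination A y) →+
          LinearMap.ker (Finsupp.linearCombination A y))
      (y' : KerIndex I → LinearMap.ker (Finsupp.linearCombination A y))
      (e' : KerIndex I → ℤ) (I' : KerIndex I → LowerSet P),
      HasPosetQuotients 𝒜 x (c + d) π' y' e' I' ∧
      ∀ j z, (π' j z : ι →₀ A) = freeProj 𝒜 e j z := by
  set Z := LinearMap.ker (Finsupp.linearCombination A y) with hZ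
  have hmem : ∀ f, f ∈ Z ↔ Finsupp.linearCombination A y f = 0 := fun f => Iff.rfl
  clear_value Z
  choose z hz hzdeg hzk hzl using h.exists_syzygy hdegP
  let π' : ℤ → Z →+ Z := fun j =>
    ((freeProj 𝒜 e j).comp Z.subtype.toAddMonoidHom).codRestrict Z fun z => by
      change freeProj 𝒜 e j z ∈ Z
      rw [hmem, h.map_freeProj, (hmem z).1 z.2, map_zero]
  have hπ' : ∀ j z, (π' j z : ι →₀ A) = freeProj 𝒜 e j z := fun j z => rfl
  let y' : KerIndex I → Z := fun s => ⟨z _ _ s.2, (hmem _).2 (hz _ _ s.2)⟩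
  let J : P → LowerSet P := fun p => ⟨{q | ¬ p ≤ q}, fun q r hrq hq hpr => hq (hpr.trans hrq)⟩
  -- The leading term of a syzygy is a combination of earlier generators, so its coefficient lies in
  -- the colon ideal.
  have coeff : ∀ (f : Z) k, (∀ l, k < l → (f : ι →₀ A) l = 0) →
      (f : ι →₀ A) k ∈ Ideal.span (x '' I k) := by
    intro f k hf
    rw [← h.smul_mem_iff, Finsupp.mem_span_image_iff_linearCombination]
    refine ⟨Finsupp.single k ((f : ι →₀ A) k) - f, ?_, ?_⟩
    · rw [Finsupp.mem_supported']
      intro l hl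
      rcases eq_or_lt_of_le (not_lt.1 hl) with rfl | hl
      · simp
      · simp [hf l hl, Finsupp.single_eq_of_ne hl.ne']
    · rw [map_sub, (hmem f).1 f.2]
      simp
  -- Every element of the ideal of `S` is the leading coefficient of a combination of the `y'` at
  -- `k` with second index in `S`.
  have reduce : ∀ (k : ι) (S : Set P), S ⊆ I k → ∀ a ∈ Ideal.span (x '' S),
      ∃ g ∈ span A (y' '' {s | (ofLex s.1).1 = k ∧ ((ofLex s.1).2 : P) ∈ S}),
        (g : ι →₀ A) k = a ∧ ∀ l, k < l → (g : ι →₀ A) l = 0 := by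
    intro k S hS a ha
    induction ha using Submodule.span_induction with
    | zero => exact ⟨0, zero_mem _, by simp, by simp⟩
    | add v w _ _ hv hw =>
      obtain ⟨g, hg, h1, h2⟩ := hv
      obtain ⟨g', hg', h1', h2'⟩ := hw
      exact ⟨g + g', add_mem hg hg', by simp [h1, h1'], fun l hl => by simp [h2 l hl, h2' l hl]⟩
    | smul b v _ hv =>
      obtain ⟨g, hg, h1, h2⟩ := hv
      exact ⟨b • g, smul_mem _ _ hg, by simp [h1], fun l hl => by simp [h2 l hl]⟩
    | mem v hv =>
      obtain ⟨p, hp, rfl⟩ := hv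
      exact ⟨y' ⟨toLex (k, p), hS hp⟩, subset_span ⟨⟨toLex (k, p), hS hp⟩, ⟨rfl, hp⟩, rfl⟩,
        hzk _ _ _, hzl _ _ _⟩
  -- As in Gröbner basis reduction, cancelling the coefficient at `k` strictly lowers the leading
  -- index.
  have gen : ∀ (k : ι) (f : Z), (∀ l, k < l → (f : ι →₀ A) l = 0) →
      f ∈ span A (y' '' {s | (ofLex s.1).1 ≤ k}) := by
    have : WellFoundedLT ι := Finite.to_wellFoundedLT
    intro k
    induction k using WellFoundedLT.induction with
    | ind k ih =>
    intro f hf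
    obtain ⟨g, hg, hgk, hgl⟩ := reduce k (I k) subset_rfl _ (coeff f k hf)
    have hg' : g ∈ span A (y' '' {s | (ofLex s.1).1 ≤ k}) :=
      span_mono (Set.image_mono fun s hs => hs.1.le) hg
    suffices f - g ∈ span A (y' '' {s | (ofLex s.1).1 ≤ k}) by
      convert add_mem this hg' using 1
      exact (sub_add_cancel f g).symm
    by_cases h0 : (f - g : Z) = 0
    · rw [h0]; exact zero_mem _
    have hne : ((f - g : Z) : ι →₀ A).support.Nonempty := by
      rw [Finsupp.support_nonempty_iff]
      exact fun h => h0 (Subtype.ext h)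
    have hmax := Finset.max'_mem _ hne
    set k' := ((f - g : Z) : ι →₀ A).support.max' hne with hk'
    have hlt : k' < k := by
      by_contra hlt
      rw [Finsupp.mem_support_iff] at hmax
      apply hmax
      rcases eq_or_lt_of_le (not_lt.1 hlt) with heq | hlt
      · rw [← heq]; simp [hgk]
      · simp [hf _ hlt, hgl _ hlt]
    refine span_mono (Set.image_mono fun s hs => ?_) (ih k' hlt (f - g) ?_)
    · exact le_trans (Set.mem_ofPred.1 hs) hlt.le
    · intro l hl
      by_contra hl0
      exact not_le.2 hl (Finset.le_max' _ _ (Finsupp.mem_support_iff.2 hl0))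
  have gen' : ∀ (k : ι) (f : Z), (∀ l, k ≤ l → (f : ι →₀ A) l = 0) →
      f ∈ span A (y' '' {s | (ofLex s.1).1 < k}) := by
    intro k f hf
    by_cases h0 : f = 0
    · rw [h0]; exact zero_mem _
    have hne : (f : ι →₀ A).support.Nonempty := by
      rw [Finsupp.support_nonempty_iff]
      exact fun h => h0 (Subtype.ext h)
    have hmax := Finset.max'_mem _ hne
    set k' := (f : ι →₀ A).support.max' hne with hk'
    have hlt : k' < k := by
      by_contra hlt
      exact (Finsupp.mem_support_iff.1 hmax) (hf _ (not_lt.1 hlt))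
    refine span_mono (Set.image_mono fun s hs => ?_) (gen k' f ?_)
    · exact lt_of_le_of_lt (Set.mem_ofPred.1 hs) hlt
    · intro l hl
      by_contra hl0
      exact not_le.2 hl (Finset.le_max' _ _ (Finsupp.mem_support_iff.2 hl0))
  refine ⟨π', y', fun s => e (ofLex s.1).1 + degP (ofLex s.1).2, fun s => J (ofLex s.1).2,
    ⟨?_, ?_, ?_, ?_, ?_⟩, hπ'⟩
  · intro i j a ha n
    exact Subtype.ext (isGradedProj_freeProj e i j a ha n)
  · intro s j
    refine Subtype.ext ?_
    have := isPure_freeProj (hzdeg _ _ s.2) j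
    rw [hπ']
    refine this.trans ?_
    split_ifs <;> rfl
  · intro s
    exact add_le_add (h.degree_le _) (hd _)
  · rw [eq_top_iff]
    intro f _
    by_cases h0 : f = 0
    · rw [h0]; exact zero_mem _
    have hne : (f : ι →₀ A).support.Nonempty := by
      rw [Finsupp.support_nonempty_iff]
      exact fun h => h0 (Subtype.ext h)
    refine span_mono (Set.image_subset_range _ _)
      (gen ((f : ι →₀ A).support.max' hne) f fun l hl => ?_)
    by_contra hl0
    exact not_le.2 hl (Finset.le_max' _ _ (Finsupp.mem_support_iff.2 hl0))
  · rintro ⟨s, hs⟩ a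
    obtain ⟨⟨k, p⟩, rfl⟩ := toLex.surjective s
    let p₀ : P := p
    -- The second indices of the generators at `k` that precede `(k, p)`. The colon ideal at `(k,
    -- p)` is that of the ideal of `S` by `x p`.
    let S : Set P := {q | q ∈ I k ∧ toLinearExtension q < p}
    have hS : IsLowerSet S := fun q r hrq hq =>
      ⟨(I k).lower hrq hq.1, lt_of_le_of_lt (toLinearExtension.monotone hrq) hq.2⟩
    have hpS : p₀ ∉ S := fun hp => lt_irrefl _ hp.2
    have hlt : Set.Iio p₀ ⊆ S := fun q (hq : q < p₀) => ⟨(I k).lower hq.le hs,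
      lt_of_le_of_ne (toLinearExtension.monotone hq.le) hq.ne⟩
    refine Iff.trans ?_ (hA.mul_mem_span_iff hS hpS hlt a)
    constructor
    · intro ha
      -- Taking the `k`-th coordinate kills generators with smaller first index and sends those at
      -- `k` preceding `(k, p)` to elements `x p'` with `p' ∈ S`.
      have hle : span A (y' '' Set.Iio ⟨toLex (k, p), hs⟩) ≤
          Submodule.comap ((Finsupp.lapply k).comp Z.subtype) (Ideal.span (x '' S)) := by
        refine span_le.2 ?_
        rintro _ ⟨⟨s, hs'⟩, hlt, rfl⟩
        obtain ⟨⟨k', p'⟩, rfl⟩ := toLex.surjective s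
        rcases Prod.Lex.lt_iff.1 (Subtype.mk_lt_mk.1 (Set.mem_Iio.1 hlt)) with h1 | ⟨h1, h2⟩
        · have : z k' p' hs' k = 0 := hzl _ _ _ _ h1
          change z k' p' hs' k ∈ Ideal.span (x '' S)
          rw [this]
          exact zero_mem _
        · obtain rfl : k' = k := h1
          have hmem' : x p' ∈ Ideal.span (x '' S) := Ideal.subset_span ⟨p', ⟨hs', h2⟩, rfl⟩
          exact (congrArg (· ∈ Ideal.span (x '' S)) (hzk k' p' hs')).mpr hmem'
      have := hle ha
      rw [← hzk k p hs]
      exact this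
    · intro ha
      -- Subtracting `g` cancels the coordinate at `k`, and by `gen'` the rest is a combination of
      -- generators with smaller first index.
      obtain ⟨g, hg, hgk, hgl⟩ := reduce k S (fun q hq => hq.1) _ ha
      have hg' : g ∈ span A (y' '' Set.Iio ⟨toLex (k, p), hs⟩) := by
        refine span_mono (Set.image_mono ?_) hg
        rintro ⟨s, hs'⟩ ⟨h1, h2⟩
        exact Set.mem_Iio.2 (Subtype.coe_lt_coe.1 <| Prod.Lex.lt_iff.2 (Or.inr ⟨h1, h2.2⟩))
      suffices a • y' ⟨toLex (k, p), hs⟩ - g ∈ span A (y' '' Set.Iio ⟨toLex (k, p), hs⟩) by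
        convert add_mem this hg' using 1
        exact (sub_add_cancel _ g).symm
      refine span_mono (Set.image_mono ?_) (gen' k _ ?_)
      · rintro ⟨s, hs'⟩ h1
        exact Set.mem_Iio.2 (Subtype.coe_lt_coe.1 <| Prod.Lex.lt_iff.2 (Or.inl h1))
      · intro l hl
        rcases eq_or_lt_of_le hl with rfl | hl
        · change a * z k p hs k - (g : ι →₀ A) k = 0
          have : z k p₀ hs k = x p₀ := hzk k p₀ hs
          exact sub_eq_zero.2 ((congrArg (a * ·) this).trans hgk.symm)
        · have : z k p hs l = 0 := hzl _ _ _ _ hl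
          simp [y', hgl l hl, this]

end HasPosetQuotients

end Graded
-- Comparison with an arbitrary graded free resolution, and vanishing of Tor
section Comparison

open Submodule

variable {K A P : Type*} [Field K] [CommRing A] [Algebra K A] [PartialOrder P]
  {𝒜 : ℤ → Submodule K A} [GradedAlgebra 𝒜]

theorem map_mem_smul_top {N N' : Type*} [AddCommMonoid N] [Module A N] [AddCommMonoid N']
    [Module A N'] (T : N →ₗ[A] N') (J : Ideal A) {n : N} (hn : n ∈ J • (⊤ : Submodule A N)) :
    T n ∈ J • (⊤ : Submodule A N') := by
  have := Submodule.mem_map_of_mem (f := T) hn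
  rw [Submodule.map_smul''] at this
  exact smul_mono le_rfl le_top this

theorem proj_mem_positiveIdeal {a : A} (ha : a ∈ positiveIdeal 𝒜) (i : ℤ) :
    (DirectSum.decompose 𝒜 a i : A) ∈ positiveIdeal 𝒜 := by
  have : (positiveIdeal 𝒜).IsHomogeneous 𝒜 :=
    Ideal.homogeneous_span 𝒜 _ fun a ⟨i, _, ha⟩ => ⟨i, ha⟩
  exact this i ha

theorem IsGradedProj.proj_mem {N : Type*} [AddCommGroup N] [Module A N] {π : ℤ → N →+ N}
    (h : IsGradedProj 𝒜 π) {n : N} (hn : n ∈ positiveIdeal 𝒜 • (⊤ : Submodule A N)) (j : ℤ) :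
    π j n ∈ positiveIdeal 𝒜 • (⊤ : Submodule A N) := by
  classical
  induction hn using Submodule.smul_induction_on' with
  | add v _ w _ hv hw => rw [map_add]; exact add_mem hv hw
  | smul a ha n _ =>
    rw [← DirectSum.sum_support_decompose 𝒜 a, Finset.sum_smul, map_sum]
    refine sum_mem fun i _ => ?_
    have := h i (j - i) _ (DirectSum.decompose 𝒜 a i).2 n
    rw [add_sub_cancel] at this
    rw [this]
    exact smul_mem_smul (proj_mem_positiveIdeal ha i) trivial

/-- The projection of a graded module to its part of degree `j`. -/
def decomposeProj {M : Type*} [AddCommGroup M] [Module K M] (ℳ : ℤ → Submodule K M)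
    [DirectSum.Decomposition ℳ] (j : ℤ) : M →+ M :=
  (ℳ j).subtype.toAddMonoidHom.comp
    ((DFinsupp.evalAddMonoidHom j).comp (DirectSum.decomposeAddEquiv ℳ).toAddMonoidHom)

theorem decomposeProj_apply {M : Type*} [AddCommGroup M] [Module K M] (ℳ : ℤ → Submodule K M)
    [DirectSum.Decomposition ℳ] (j : ℤ) (m : M) :
    decomposeProj ℳ j m = (DirectSum.decompose ℳ m j : M) :=
  rfl

theorem isPure_decomposeProj {M : Type*} [AddCommGroup M] [Module K M] (ℳ : ℤ → Submodule K M)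
    [DirectSum.Decomposition ℳ] {e : ℤ} {m : M} (hm : m ∈ ℳ e) :
    IsPure (decomposeProj ℳ) e m := by
  intro j
  rw [decomposeProj_apply]
  split_ifs with h
  · subst h; exact DirectSum.decompose_of_mem_same ℳ hm
  · exact DirectSum.decompose_of_mem_ne ℳ hm (Ne.symm h)

omit [GradedAlgebra 𝒜] in
theorem isGradedProj_decomposeProj {M : Type*} [AddCommGroup M] [Module K M] [Module A M]
    (ℳ : ℤ → Submodule K M) [DirectSum.Decomposition ℳ] [SetLike.GradedSMul 𝒜 ℳ] :
    IsGradedProj 𝒜 (decomposeProj ℳ) := by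
  intro i j a ha m
  induction m using DirectSum.Decomposition.inductionOn ℳ with
  | zero => simp
  | add m n hm hn => simp [hm, hn]
  | @homogeneous e m =>
    have ham : a • (m : M) ∈ ℳ (i + e) := SetLike.GradedSMul.smul_mem ha m.2
    rw [isPure_decomposeProj ℳ ham, isPure_decomposeProj ℳ m.2]
    by_cases h : j = e
    · simp [h]
    · simp [h]

variable {x : P → A} {c : ℤ} {N N' ι : Type*} [AddCommGroup N] [Module A N] [AddCommGroup N']
  [Module A N'] [LinearOrder ι] {π : ℤ → N' →+ N'} {y : ι → N'} {e : ι → ℤ} {I : ι → LowerSet P}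

/-- A map `N → N'` that has a left inverse up to maps which factor through a projective module
induces such a map between first syzygy modules. -/
theorem HasPosetQuotients.exists_syzygy_map (h : HasPosetQuotients 𝒜 x c π y e I)
    {κ L : Type*} (eκ : κ → ℤ) [AddCommGroup L] [Module A L]
    (ε : (κ →₀ A) →ₗ[A] N) (hε : Function.Surjective ε)
    (φ : N →ₗ[A] N') (ψ : N' →ₗ[A] N) (α : N →ₗ[A] L) (β : L →ₗ[A] N) [Module.Projective A L]
    (hψφ : ∀ n, n - ψ (φ n) = β (α n))
    (hφ : ∀ k, π (eκ k) (φ (ε (Finsupp.single k 1))) = φ (ε (Finsupp.single k 1)))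
    (S : Submodule A (κ →₀ A)) (hS : S = LinearMap.ker ε) :
    ∃ (φ' : S →ₗ[A] LinearMap.ker (Finsupp.linearCombination A y))
      (ψ' : LinearMap.ker (Finsupp.linearCombination A y) →ₗ[A] S) (β' : (κ →₀ A) →ₗ[A] S),
      (∀ s : S, s - ψ' (φ' s) = β' s) ∧
      ∀ j, ∀ s : S, (s : κ →₀ A) ∈ freePiece 𝒜 eκ j →
        (φ' s : ι →₀ A) ∈ freePiece 𝒜 e j := by
  subst hS
  choose g hg hgy using fun k => h.exists_mem_freePiece (hφ k)
  let φ₀ : (κ →₀ A) →ₗ[A] (ι →₀ A) := Finsupp.linearCombination A g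
  have hφ₀ : ∀ f, Finsupp.linearCombination A y (φ₀ f) = φ (ε f) := by
    intro f
    have : Finsupp.linearCombination A y ∘ₗ φ₀ = φ ∘ₗ ε := by
      ext k
      simp [φ₀, hgy]
    exact LinearMap.congr_fun this f
  have hφ₀deg : ∀ j f, f ∈ freePiece 𝒜 eκ j → φ₀ f ∈ freePiece 𝒜 e j := by
    intro j f hf
    have hf' := (mem_freePiece_iff eκ).1 hf
    rw [show φ₀ f = f.sum fun k a => a • g k from Finsupp.linearCombination_apply _ _]
    refine sum_mem fun k _ => (mem_freePiece_iff e).2 fun l => ?_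
    have := SetLike.mul_mem_graded (hf' k) ((mem_freePiece_iff e).1 (hg k) l)
    rw [show j - eκ k + (eκ k - e l) = j - e l by ring] at this
    exact this
  -- Unlike `φ₀`, the lifts of `ψ` and `β` need not be homogeneous: degrees are tracked only along
  -- `φ`.
  obtain ⟨ψ₀, hψ₀⟩ := Module.projective_lifting_property ε (ψ ∘ₗ Finsupp.linearCombination A y) hε
  obtain ⟨β₀, hβ₀⟩ := Module.projective_lifting_property ε β hε
  have hψ₀' : ∀ f, ε (ψ₀ f) = ψ (Finsupp.linearCombination A y f) := LinearMap.congr_fun hψ₀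
  have hβ₀' : ∀ f, ε (β₀ f) = β f := LinearMap.congr_fun hβ₀
  have hφker : ∀ s ∈ LinearMap.ker ε, φ₀ s ∈ LinearMap.ker (Finsupp.linearCombination A y) := by
    intro s hs
    rw [LinearMap.mem_ker] at hs ⊢
    rw [hφ₀, hs, map_zero]
  have hψker : ∀ s ∈ LinearMap.ker (Finsupp.linearCombination A y), ψ₀ s ∈ LinearMap.ker ε := by
    intro s hs
    rw [LinearMap.mem_ker] at hs ⊢
    rw [hψ₀', hs, map_zero]
  -- The third map lands in `ker ε` on the whole free module because `β ∘ α` is the defect of `ψ ∘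
  -- φ`. Its last term vanishes on `ker ε`, so there it is the new defect, now factored through a
  -- free module.
  refine ⟨φ₀.restrict hφker, ψ₀.restrict hψker,
    (LinearMap.id - ψ₀ ∘ₗ φ₀ - β₀ ∘ₗ α ∘ₗ ε).codRestrict _ fun s => ?h, ?_, ?_⟩
  case h =>
    rw [LinearMap.mem_ker]
    simp [hψ₀', hβ₀', hφ₀, ← hψφ]
  · rintro ⟨s, hs⟩
    refine Subtype.ext ?_
    change s - ψ₀ (φ₀ s) = s - ψ₀ (φ₀ s) - β₀ (α (ε s))
    rw [LinearMap.mem_ker.1 hs]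
    simp
  · rintro j ⟨s, hs⟩ hj
    exact hφ₀deg j s hj

namespace GradedFreeResolution

theorem map_single_mem {M : Type*} [AddCommGroup M] [Module K M] [Module A M]
    {ℳ : ℤ → Submodule K M} (F : GradedFreeResolution 𝒜 ℳ) (n : ℕ) (k : F.ι (n + 1)) :
    F.d n (Finsupp.single k 1) ∈ freePiece 𝒜 (F.e n) (F.e (n + 1) k) :=
  F.d_homogeneous n _ _ (single_mem_freePiece _ k)

/-- Induction along `F`, replacing both modules by their first syzygies. Starting at the image of `d
0` rather than at `M` keeps every `N` in one universe; the universe of `Q` absorbs that of `P`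
because the new index sets are built from pairs in `ι × P`. -/
theorem exists_comparison.{w, uK, uA, uP, uM, uQ} {K : Type uK} {A : Type uA} {P : Type uP}
    {M : Type uM} {Q : Type (max uP uQ)} [Field K] [CommRing A] [Algebra K A]
    [AddCommGroup M] [Module K M] [Module A M]
    [PartialOrder P] [Finite P] [LinearOrder Q] [Finite Q]
    {𝒜 : ℤ → Submodule K A} [GradedAlgebra 𝒜] {ℳ : ℤ → Submodule K M}
    {x : P → A} (hA : IsASL 𝒜 x) {π : ℤ → M →+ M} (hπ : ∀ j, ∀ m ∈ ℳ j, π j m = m) {c : ℤ}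
    {y : Q → M} {e : Q → ℤ} {I : Q → LowerSet P} (h : HasPosetQuotients 𝒜 x c π y e I)
    {degP : P → ℤ} (hdegP : ∀ p, x p ∈ 𝒜 (degP p)) {d : ℤ} (hd : ∀ p, degP p ≤ d)
    (F : GradedFreeResolution.{w} 𝒜 ℳ) (n : ℕ) :
    ∃ (ι : Type (max uP uQ)) (_ : LinearOrder ι) (_ : Finite ι)
      (N : Type (max uA uP uQ)) (_ : AddCommGroup N) (_ : Module A N) (π : ℤ → N →+ N)
      (y : ι → N) (e : ι → ℤ) (I : ι → LowerSet P)
      (_ : HasPosetQuotients 𝒜 x (c + (n + 1) * d) π y e I)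
      (φ : LinearMap.range (F.d n) →ₗ[A] N) (ψ : N →ₗ[A] LinearMap.range (F.d n))
      (β : (F.ι n →₀ A) →ₗ[A] LinearMap.range (F.d n)),
      (∀ s : LinearMap.range (F.d n), s - ψ (φ s) = β s) ∧
      ∀ j, ∀ s : LinearMap.range (F.d n), (s : F.ι n →₀ A) ∈ freePiece 𝒜 (F.e n) j →
        π j (φ s) = φ s := by
  induction n with
  | zero =>
    have hrange : LinearMap.range (F.d 0) = LinearMap.ker F.ε :=
      (LinearMap.exact_iff.1 F.exact_zero).symm
    obtain ⟨π', y', e', I', h', hπ'⟩ := h.exists_ker hA hdegP hd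
    obtain ⟨φ, ψ, β, h1, h2⟩ := h.exists_syzygy_map (F.e 0) F.ε F.ε_surjective
      LinearMap.id LinearMap.id (0 : M →ₗ[A] A) 0 (by simp)
      (fun k => hπ _ _ (F.ε_homogeneous _ _ (single_mem_freePiece _ k))) _ hrange
    refine ⟨HasPosetQuotients.KerIndex I, inferInstance, inferInstance, _, _, _, π', y', e', I',
      by simpa using h', φ, ψ, β, h1, fun j s hs => Subtype.ext ?_⟩
    rw [hπ']
    exact (isPure_freeProj (h2 j s hs)).proj_self
  | succ n ih =>
    obtain ⟨ι, _, _, N, _, _, π, y, e, I, h, φ, ψ, β, h3, h4⟩ := ih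
    have hrange : LinearMap.range (F.d (n + 1)) = LinearMap.ker (F.d n).rangeRestrict := by
      rw [LinearMap.ker_rangeRestrict]
      exact (LinearMap.exact_iff.1 (F.exact_succ n)).symm
    obtain ⟨π', y', e', I', h', hπ'⟩ := h.exists_ker hA hdegP hd
    obtain ⟨φ', ψ', β', h1, h2⟩ := h.exists_syzygy_map (N := LinearMap.range (F.d n)) (F.e (n + 1)) (F.d n).rangeRestrict
      (F.d n).surjective_rangeRestrict φ ψ (LinearMap.range (F.d n)).subtype β h3
      (fun k => h4 _ _ (F.map_single_mem n k)) _ hrange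
    refine ⟨HasPosetQuotients.KerIndex I, inferInstance, inferInstance, _, _, _, π', y', e', I',
      ?_, φ', ψ', β', h1, fun j s hs => Subtype.ext ?_⟩
    · convert h' using 1
      push_cast
      ring
    · rw [hπ']
      exact (isPure_freeProj (h2 j s hs)).proj_self

/-- For a cycle `z` in degree `j`, it suffices that `w = d z` lies in `A₊` times the image of `d`,
not merely in `A₊ Fₙ`. Write `w = β w + ψ (φ w)`. The first term is good since `β` is defined on all
of `Fₙ`, the second since `φ w` has degree above all generators of `N`. -/
theorem subsingleton_tor.{w, uK, uA, uP, uM, uQ} {K : Type uK} {A : Type uA} {P : Type uP}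
    {M : Type uM} {Q : Type uQ} [Field K] [CommRing A] [Algebra K A]
    [AddCommGroup M] [Module K M] [Module A M]
    [PartialOrder P] {𝒜 : ℤ → Submodule K A} [GradedAlgebra 𝒜] {x : P → A} {c : ℤ}
    [Finite P] [LinearOrder Q] [Finite Q] {ℳ : ℤ → Submodule K M}
    (hA : IsASL 𝒜 x) {π : ℤ → M →+ M} (hπ : ∀ j, ∀ m ∈ ℳ j, π j m = m)
    {y : Q → M} {e : Q → ℤ} {I : Q → LowerSet P} (h : HasPosetQuotients 𝒜 x c π y e I)
    {degP : P → ℤ} (hdegP : ∀ p, x p ∈ 𝒜 (degP p)) {d : ℤ} (hd : ∀ p, degP p ≤ d)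
    (F : GradedFreeResolution.{w} 𝒜 ℳ) (n : ℕ) {j : ℤ} (hj : c + (n + 1) * d < j) :
    Subsingleton (F.Tor (n + 1) j) := by
  let f : ULift.{uP} Q ≃o Q := { Equiv.ulift with map_rel_iff' := Iff.rfl }
  obtain ⟨ι, _, _, N, _, _, π, y, e, I, h, φ, ψ, β, h3, h4⟩ :=
    exists_comparison.{w, uK, uA, uP, uM, uQ} hA hπ (h.comp_orderIso f) hdegP hd F n
  rw [Submodule.Quotient.subsingleton_iff, eq_top_iff]
  rintro ⟨_, ⟨z, hz, rfl⟩, hker⟩ -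
  have hz' : F.d n z ∈ positiveIdeal 𝒜 • (⊤ : Submodule A (F.ι n →₀ A)) := by
    have : F.chainD n (Submodule.Quotient.mk z) = 0 := hker
    rw [chainD, Submodule.mapQ_apply, Submodule.Quotient.mk_eq_zero] at this
    exact this
  let w : LinearMap.range (F.d n) := ⟨F.d n z, z, rfl⟩
  have hw : w ∈ positiveIdeal 𝒜 • (⊤ : Submodule A (LinearMap.range (F.d n))) := by
    have h5 := map_mem_smul_top β _ hz'
    have h6 := map_mem_smul_top ψ _
      (h.mem_positiveIdeal_smul_top (h4 j w (F.d_homogeneous n j z hz)) hj)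
    rw [← show w - ψ (φ w) = β (F.d n z) from h3 w] at h5
    convert add_mem h5 h6 using 1
    exact (sub_add_cancel w _).symm
  obtain ⟨z', hz', hzz'⟩ : ∃ z' ∈ positiveIdeal 𝒜 • (⊤ : Submodule A (F.ι (n + 1) →₀ A)),
      F.d n z' = F.d n z := by
    have hmap : (positiveIdeal 𝒜 • (⊤ : Submodule A (F.ι (n + 1) →₀ A))).map
        (F.d n).rangeRestrict = positiveIdeal 𝒜 • ⊤ := by
      rw [Submodule.map_smul'', Submodule.map_top, LinearMap.range_rangeRestrict]
    rw [← hmap] at hw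
    obtain ⟨z', hz', h⟩ := hw
    exact ⟨z', hz', congrArg Subtype.val h⟩
  -- Here `z'` vanishes modulo `A₊`, so `z` becomes a boundary. Since `u` need not be homogeneous,
  -- its degree `j` component is used below.
  obtain ⟨u, hu⟩ := (F.exact_succ n (z - z')).1 (by rw [map_sub, hzz', sub_self])
  refine ⟨Submodule.Quotient.mk (freeProj 𝒜 (F.e (n + 2)) j u), ⟨_, freeProj_mem _ _ _, rfl⟩, ?_⟩
  change F.chainD (n + 1) (Submodule.Quotient.mk _) = Submodule.Quotient.mk z
  rw [chainD, Submodule.mapQ_apply, Submodule.Quotient.eq,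
    map_freeProj (F.e (n + 2)) (isGradedProj_freeProj (F.e (n + 1)))
      (F.d (n + 1)) (fun k => isPure_freeProj (F.map_single_mem (n + 1) k)), hu, map_sub,
    (isPure_freeProj hz).proj_self, sub_sub_cancel_left]
  exact neg_mem ((isGradedProj_freeProj _).proj_mem hz' j)

end GradedFreeResolution

end Comparison

/-! ### The bound on the rate -/

theorem le_maxDegree {ι : Type*} [Finite ι] (deg : ι → ℤ) (i : ι) : deg i ≤ maxDegree deg :=
  le_ciSup (Set.finite_range deg).bddAbove i

theorem mainTheorem6 {K A M P Q : Type*}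
    [Field K] [CommRing A] [Algebra K A]
    [AddCommGroup M] [Module K M] [Module A M] [IsScalarTower K A M]
    [PartialOrder P] [Finite P] [PartialOrder Q] [Finite Q]
    (𝒜 : ℤ → Submodule K A) [GradedAlgebra 𝒜]
    (ℳ : ℤ → Submodule K M) [DirectSum.Decomposition ℳ] [SetLike.GradedSMul 𝒜 ℳ]
    (x : P → A) (hA : IsASL 𝒜 x)
    (y : Q → M) (hM : IsMSL x ℳ y)
    (degP : P → ℤ) (hdegP : ∀ p, x p ∈ 𝒜 (degP p))
    (degQ : Q → ℤ) (hdegQ : ∀ q, y q ∈ ℳ (degQ q))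
    (hm : 0 ≤ maxDegree degQ)
    (F : GradedFreeResolution 𝒜 ℳ) :
    F.rate ≤ ((maxDegree degP + maxDegree degQ : ℤ) : ℝ) := by
  obtain ⟨I, htop, hI⟩ := hM.exists_smul_mem_span_iff hA
  have : Finite (LinearExtension Q) := inferInstanceAs (Finite Q)
  have h : HasPosetQuotients 𝒜 x (maxDegree degQ) (decomposeProj ℳ)
      (fun q : LinearExtension Q => y q) (fun q : LinearExtension Q => degQ q) I :=
    { isGradedProj := isGradedProj_decomposeProj ℳ
      isPure := fun q => isPure_decomposeProj ℳ (hdegQ q)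
      degree_le := fun q => le_maxDegree degQ q
      span_eq_top := htop
      smul_mem_iff := hI }
  have hπ : ∀ j, ∀ m ∈ ℳ j, decomposeProj ℳ j m = m :=
    fun j m hmj => (isPure_decomposeProj ℳ hmj).proj_self
  refine iSup₂_le fun i hi => ?_
  obtain ⟨n, rfl⟩ := Nat.exists_eq_add_of_le' hi
  rw [EReal.div_le_iff_le_mul (by exact_mod_cast Nat.succ_pos n) (EReal.natCast_ne_top _)]
  refine iSup₂_le fun j hj => ?_
  have hle : j ≤ maxDegree degQ + (n + 1) * maxDegree degP := by
    by_contra hlt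
    have := F.subsingleton_tor hA hπ h hdegP (le_maxDegree degP) n (not_le.1 hlt)
    exact not_nontrivial _ hj
  -- The two bounds differ by `n * maxDegree degQ`, which is nonnegative by `hm`.
  have : j ≤ (n + 1 : ℤ) * (maxDegree degP + maxDegree degQ) := by nlinarith
  have hR : (j : ℝ) ≤ ((n + 1 : ℕ) : ℝ) * ((maxDegree degP + maxDegree degQ : ℤ) : ℝ) := by
    exact_mod_cast this
  exact_mod_cast hR
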